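/- Let $V$ be a semicartesian monoidal category (its unit object is terminal). Let $W$ be a closed symmetric monoidal model category with cofibrant unit object $I$ satisfying the pushout-product axiom (for instance a symmetric monoidal simplicial model category). Let $\Bbbk$ be a commutative ring, and let $\chi$ be a multiplicative Euler characteristic on $W$ with values in $\Bbbk$: a partial function on the objects of $W$ (the objects of its domain are called finite) such that (i) weakly equivalent objects are simultaneously finite and have the same $\chi$; (ii) the initial object is finite with $\chi(\emptyset)=0$; (iii) the homotopy pushout $P$ of a span $B\leftarrow A\to C$ of finite objects is finite, with $\chi(P)=\chi(B)+\chi(C)-\chi(A)$; (iv) $I$ is finite with $\chi(I)=1$; (v) if $A,B$ are finite and cofibrant, then $A\otimes B$ is finite and $\chi(A\otimes B)=\chi(A)\chi(B)$. Let $\Sigma:V\to W$ be a strong monoidal functor with finite values, and put $\#=\chi\circ\Sigma$. Let $X$ be a $V$-category with finitely many objects such that the $W$-category $\Sigma X$, with hom-objects $\Sigma(X(x,y))$, is cofibrant: all $\Sigma(X(x,y))$ are cofibrant and all identity-assigning maps $I\to\Sigma(X(x,x))$ are cofibrations. Suppose that $X$ has Möbius inversion, i.e. that the matrix $Z_X=(\#X(x,y))_{x,y}$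 is invertible over $\Bbbk$. The magnitude of $X$ is the sum of all entries of $Z_X^{-1}$. For objects $x_0,\dots,x_n$ of $X$ let $$B_{x_0,\dots,x_n}=\Sigma X(x_0,x_1)\otimes\cdots\otimes\Sigma X(x_{n-1},x_n)\otimes\Sigma(1),$$ where $1$ is the unit object of $V$. A degeneracy operator $(y_0,\dots,y_k)\to(x_0,\dots,x_n)$ is a monotone surjection $\sigma:\{0,\dots,n\}\to\{0,\dots,k\}$ with $x_i=y_{\sigma(i)}$ for all $i$; it induces a map $B_{y_0,\dots,y_k}\to B_{x_0,\dots,x_n}$ inserting identities of $\Sigma X$. Let $L_{x_0,\dots,x_n}$ be the latching object, i.e. the colimit of the objects $B_{y_0,\dots,y_k}$ over all degeneracy operators $(y_0,\dots,y_k)\to(x_0,\dots,x_n)$ with $k<n$. Then all $B_{x_0,\dots,x_n}$ and $L_{x_0,\dots,x_n}$ are finite, so that $$\mathrm{wgt}(x_0,\dots,x_n)=\chi(B_{x_0,\dots,x_n})-\chi(L_{x_0,\dots,x_n})$$ is defined, and the formal power series $$F(t)=\sum_{n\ge 0}t^n\sum_{x_0,\dots,x_n}\mathrm{wgt}(x_0,\dots,x_n)\in\Bbbk[[t]]$$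 is a rational function whose value at $t=-1$ is defined and is the magnitude of $X$. That is, there are polynomials $P,Q\in\Bbbk[t]$, with $Q$ invertible in $\Bbbk[[t]]$ and $Q(-1)$ invertible in $\Bbbk$, such that $QF=P$ in $\Bbbk[[t]]$ and $P(-1)/Q(-1)$ is the magnitude of $X$. (If $\Bbbk$ is a field, this says that the image of $F$ in $\Bbbk((t))$ is the image of an element of $\Bbbk(t)$ which is defined at $t=-1$ and whose value there is the magnitude of $X$.) -/

import Mathlib

open CategoryTheory MonoidalCategory Limits HomotopicalAlgebra

universe w v v₁ v₂ u u₁ u₂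

/-! ### Magnitude of an enriched category -/

section Magnitude

/-- The zeta function of a `V`-category `X` with finitely many objects, with respect to
`size : ob V → k`, as a matrix. -/
def zetaMatrix {V : Type u₁} [Category.{v₁} V] [MonoidalCategory V] {k : Type u}
    (size : V → k) (X : Type w) [EnrichedCategory V X] : Matrix X X k :=
  Matrix.of fun x y => size (x ⟶[V] y)

/-- `X` has Möbius inversion: its zeta matrix is invertible over `k`. -/
def HasMobiusInversion {V : Type u₁} [Category.{v₁} V] [MonoidalCategory V] {k : Type u}
    [CommRing k] (size : V → k) (X : Type w) [EnrichedCategory V X] [Fintype X]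
    [DecidableEq X] : Prop :=
  IsUnit (zetaMatrix size X)

/-- The magnitude of `X`: the sum of all entries of the inverse of the zeta matrix
(meaningful when `X` has Möbius inversion). -/
noncomputable def magnitude {V : Type u₁} [Category.{v₁} V] [MonoidalCategory V] {k : Type u}
    [CommRing k] (size : V → k) (X : Type w) [EnrichedCategory V X] [Fintype X]
    [DecidableEq X] : k :=
  ∑ x : X, ∑ y : X, (zetaMatrix size X)⁻¹ x y

end Magnitude

/-! ### Monoidal model categories, homotopy pushouts, Euler characteristics -/

section EulerCharacteristic

variable (W : Type u₂) [Category.{v₂} W] [ModelCategory W]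

/-- The compatibility of a monoidal structure with a model structure: the unit object is
cofibrant and the pushout-product axiom holds. (The pushout product of `f : A ⟶ B` and
`g : K ⟶ L` is the map `ι` from the pushout of `f ▷ K` and `A ◁ g` to `B ⊗ L`.) -/
class IsMonoidalModelCategory [MonoidalCategory W] : Prop where
  isCofibrant_unit : IsCofibrant (𝟙_ W)
  cofibration_ι {A B K L : W} (f : A ⟶ B) (g : K ⟶ L)
    (sq : (curriedTensor W).PushoutObjObj f g) :
    Cofibration f → Cofibration g → Cofibration sq.ι
  weakEquivalence_ι_left {A B K L : W} (f : A ⟶ B) (g : K ⟶ L)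
    (sq : (curriedTensor W).PushoutObjObj f g) :
    Cofibration f → Cofibration g → WeakEquivalence f → WeakEquivalence sq.ι
  weakEquivalence_ι_right {A B K L : W} (f : A ⟶ B) (g : K ⟶ L)
    (sq : (curriedTensor W).PushoutObjObj f g) :
    Cofibration f → Cofibration g → WeakEquivalence g → WeakEquivalence sq.ι

variable {W}

/-- `P` is a homotopy pushout of the span `B ⟵ A ⟶ C`: it is the pushout of a span
`B' ⟵ A' ⟶ C'` of two cofibrations with cofibrant source which is weakly equivalent to the
given span. (It is well defined up to weak equivalence.) -/
def IsHomotopyPushout {A B C : W} (f : A ⟶ B) (g : A ⟶ C) (P : W) : Prop :=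
  ∃ (A' B' C' : W) (f' : A' ⟶ B') (g' : A' ⟶ C') (a : A' ⟶ A) (b : B' ⟶ B) (c : C' ⟶ C)
    (inl : B' ⟶ P) (inr : C' ⟶ P),
    IsCofibrant A' ∧ Cofibration f' ∧ Cofibration g' ∧
    WeakEquivalence a ∧ WeakEquivalence b ∧ WeakEquivalence c ∧
    f' ≫ b = a ≫ f ∧ g' ≫ c = a ≫ g ∧ IsPushout f' g' inl inr

variable (W)

/-- An Euler characteristic on a model category, with values in an abelian group: a partial
function on objects, with domain the objects satisfying `IsFinite`. It is represented by
a function `chi` whose values on other objects are arbitrary. -/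
structure EulerCharacteristic (k : Type u) [AddCommGroup k] where
  IsFinite : W → Prop
  chi : W → k
  isFinite_iff_of_weakEquivalence {A B : W} (f : A ⟶ B) :
    WeakEquivalence f → (IsFinite A ↔ IsFinite B)
  chi_eq_of_weakEquivalence {A B : W} (f : A ⟶ B) :
    WeakEquivalence f → IsFinite A → chi A = chi B
  isFinite_initial : IsFinite (⊥_ W)
  chi_initial : chi (⊥_ W) = 0
  isFinite_homotopyPushout {A B C : W} (f : A ⟶ B) (g : A ⟶ C) (P : W) :
    IsFinite A → IsFinite B → IsFinite C → IsHomotopyPushout f g P → IsFinite P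
  chi_homotopyPushout {A B C : W} (f : A ⟶ B) (g : A ⟶ C) (P : W) :
    IsFinite A → IsFinite B → IsFinite C → IsHomotopyPushout f g P →
      chi P = chi B + chi C - chi A

variable {W}

/-- An Euler characteristic with values in a ring, on a monoidal model category, is
multiplicative. -/
structure EulerCharacteristic.IsMultiplicative [MonoidalCategory W] {k : Type u} [CommRing k]
    (χ : EulerCharacteristic W k) : Prop where
  isFinite_unit : χ.IsFinite (𝟙_ W)
  chi_unit : χ.chi (𝟙_ W) = 1
  isFinite_tensor (A B : W) : χ.IsFinite A → χ.IsFinite B → IsCofibrant A → IsCofibrant B →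
    χ.IsFinite (A ⊗ B)
  chi_tensor (A B : W) : χ.IsFinite A → χ.IsFinite B → IsCofibrant A → IsCofibrant B →
    χ.chi (A ⊗ B) = χ.chi A * χ.chi B

/-- The size `χ ∘ Σ` on `V` induced by `χ` and a functor `Σ : V ⥤ W`. -/
def EulerCharacteristic.size {k : Type u} [AddCommGroup k] (χ : EulerCharacteristic W k)
    {V : Type u₁} [Category.{v₁} V] (S : V ⥤ W) : V → k :=
  fun a => χ.chi (S.obj a)

/-- A `W`-category is cofibrant if all its hom-objects are cofibrant and all the
identity-assigning maps `𝟙_ W ⟶ Y(y, y)` are cofibrations. -/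
def IsCofibrantEnriched (W : Type u₂) [Category.{v₂} W] [ModelCategory W] [MonoidalCategory W]
    (Y : Type w) [EnrichedCategory W Y] : Prop :=
  (∀ y y' : Y, IsCofibrant (y ⟶[W] y')) ∧ ∀ y : Y, Cofibration (eId W y)

end EulerCharacteristic

/-! ### Bimodules, and the bimodule constant at the unit -/

section Bimodule

/-- A `Y`-`Y`-bimodule (a `W`-functor `Yᵒᵖ ⊗ Y ⟶ W`, given by its two actions), contravariant in the first and covariant in the second variable. -/
structure EnrichedBimodule (W : Type u₂) [Category.{v₂} W] [MonoidalCategory W] (Y : Type w)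
    [EnrichedCategory W Y] where
  obj : Y → Y → W
  actL (x y z : Y) : (x ⟶[W] y) ⊗ obj y z ⟶ obj x z
  actR (x y z : Y) : obj x y ⊗ (y ⟶[W] z) ⟶ obj x z
  id_actL (x y : Y) : (λ_ (obj x y)).inv ≫ eId W x ▷ obj x y ≫ actL x x y = 𝟙 _
  actR_id (x y : Y) : (ρ_ (obj x y)).inv ≫ obj x y ◁ eId W y ≫ actR x y y = 𝟙 _
  actL_actL (x y z t : Y) :
    (α_ (x ⟶[W] y) (y ⟶[W] z) (obj z t)).inv ≫ eComp W x y z ▷ obj z t ≫ actL x z t =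
      (x ⟶[W] y) ◁ actL y z t ≫ actL x y t
  actR_actR (x y z t : Y) :
    (α_ (obj x y) (y ⟶[W] z) (z ⟶[W] t)).inv ≫ actR x y z ▷ (z ⟶[W] t) ≫ actR x z t =
      obj x y ◁ eComp W y z t ≫ actR x y t
  actL_actR (x y z t : Y) :
    (α_ (x ⟶[W] y) (obj y z) (z ⟶[W] t)).inv ≫ actL x y z ▷ (z ⟶[W] t) ≫ actR x z t =
      (x ⟶[W] y) ◁ actR y z t ≫ actL x y t

variable {V : Type u₁} [Category.{v₁} V] [SemiCartesianMonoidalCategory V]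
  {W : Type u₂} [Category.{v₂} W] [MonoidalCategory W]

section

open Functor.LaxMonoidal SemiCartesianMonoidalCategory

variable (S : V ⥤ W) [S.LaxMonoidal]

lemma unitBimodule_id_actL {A : V} (e : 𝟙_ V ⟶ A) :
    (λ_ (S.obj (𝟙_ V))).inv ≫ (ε S ≫ S.map e) ▷ S.obj (𝟙_ V) ≫ μ S A (𝟙_ V) ≫
      S.map (toUnit _) = 𝟙 _ := by
  simp only [comp_whiskerRight, Category.assoc, μ_natural_left_assoc, left_unitality_inv_assoc,
    ← S.map_comp]
  rw [← S.map_id]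
  congr 1
  exact toUnit_unique _ _

lemma unitBimodule_actR_id {A : V} (e : 𝟙_ V ⟶ A) :
    (ρ_ (S.obj (𝟙_ V))).inv ≫ S.obj (𝟙_ V) ◁ (ε S ≫ S.map e) ≫ μ S (𝟙_ V) A ≫
      S.map (toUnit _) = 𝟙 _ := by
  simp only [MonoidalCategory.whiskerLeft_comp, Category.assoc, μ_natural_right_assoc,
    right_unitality_inv_assoc, ← S.map_comp]
  rw [← S.map_id]
  congr 1
  exact toUnit_unique _ _

lemma unitBimodule_actL_actL {A B C : V} (m : A ⊗ B ⟶ C) :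
    (α_ (S.obj A) (S.obj B) (S.obj (𝟙_ V))).inv ≫ (μ S A B ≫ S.map m) ▷ S.obj (𝟙_ V) ≫
        μ S C (𝟙_ V) ≫ S.map (toUnit _) =
      S.obj A ◁ (μ S B (𝟙_ V) ≫ S.map (toUnit _)) ≫ μ S A (𝟙_ V) ≫ S.map (toUnit _) := by
  simp only [comp_whiskerRight, MonoidalCategory.whiskerLeft_comp, Category.assoc,
    μ_natural_left_assoc, μ_natural_right_assoc, ← associativity_inv_assoc, ← S.map_comp]
  congr 3
  exact toUnit_unique _ _

lemma unitBimodule_actR_actR {A B C : V} (m : A ⊗ B ⟶ C) :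
    (α_ (S.obj (𝟙_ V)) (S.obj A) (S.obj B)).inv ≫ (μ S (𝟙_ V) A ≫ S.map (toUnit _)) ▷ S.obj B ≫
        μ S (𝟙_ V) B ≫ S.map (toUnit _) =
      S.obj (𝟙_ V) ◁ (μ S A B ≫ S.map m) ≫ μ S (𝟙_ V) C ≫ S.map (toUnit _) := by
  simp only [comp_whiskerRight, MonoidalCategory.whiskerLeft_comp, Category.assoc,
    μ_natural_left_assoc, μ_natural_right_assoc, ← associativity_inv_assoc, ← S.map_comp]
  congr 3
  exact toUnit_unique _ _

lemma unitBimodule_actL_actR (A B : V) :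
    (α_ (S.obj A) (S.obj (𝟙_ V)) (S.obj B)).inv ≫ (μ S A (𝟙_ V) ≫ S.map (toUnit _)) ▷ S.obj B ≫
        μ S (𝟙_ V) B ≫ S.map (toUnit _) =
      S.obj A ◁ (μ S (𝟙_ V) B ≫ S.map (toUnit _)) ≫ μ S A (𝟙_ V) ≫ S.map (toUnit _) := by
  simp only [comp_whiskerRight, MonoidalCategory.whiskerLeft_comp, Category.assoc,
    μ_natural_left_assoc, μ_natural_right_assoc, ← associativity_inv_assoc, ← S.map_comp]
  congr 3
  exact toUnit_unique _ _

end

open Functor.LaxMonoidal SemiCartesianMonoidalCategory in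
/-- The bimodule over `Σ X` obtained by applying `Σ` to the diagram constant at the unit
object of `V`, which is terminal. -/
def unitBimodule (S : V ⥤ W) [S.Monoidal] (X : Type w) [EnrichedCategory V X] :
    EnrichedBimodule W (TransportEnrichment S X) where
  obj _ _ := S.obj (𝟙_ V)
  actL x y _ := μ S (EnrichedCategory.Hom (V := V) (C := X) x y) (𝟙_ V) ≫ S.map (toUnit _)
  actR _ y z := μ S (𝟙_ V) (EnrichedCategory.Hom (V := V) (C := X) y z) ≫ S.map (toUnit _)
  id_actL x _ := unitBimodule_id_actL S (eId V (C := X) x)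
  actR_id _ y := unitBimodule_actR_id S (eId V (C := X) y)
  actL_actL x y z _ := unitBimodule_actL_actL S (eComp V (C := X) x y z)
  actR_actR _ y z t := unitBimodule_actR_actR S (eComp V (C := X) y z t)
  actL_actR _ _ _ _ := unitBimodule_actL_actR S _ _

end Bimodule

/-! ### Degeneracies, the summands of the bar construction and their latching objects -/

section Bar

/-- Nonempty lists `x₀, …, xₙ` in `Y` are written as a head `x₀` and a tail. An element of
`Degeneracy x l' l` is a degeneracy operator from `x :: l' = (y₀, …, y_k)` to
`x :: l = (x₀, …, xₙ)`, i.e. a monotone surjection `σ : {0, …, n} → {0, …, k}` with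
`x_i = y_{σ i}`: `keep` is the case `σ 0 < σ 1`, and `dup` is the case `σ 0 = σ 1`. -/
inductive Degeneracy {Y : Type w} : Y → List Y → List Y → Type w
  | nil (x : Y) : Degeneracy x [] []
  | keep (x : Y) {y : Y} {l' l : List Y} (f : Degeneracy y l' l) :
      Degeneracy x (y :: l') (y :: l)
  | dup {x : Y} {l' l : List Y} (f : Degeneracy x l' l) : Degeneracy x l' (x :: l)

namespace Degeneracy

variable {Y : Type w}

/-- The identity degeneracy operator. -/
def id : (x : Y) → (l : List Y) → Degeneracy x l l
  | x, [] => nil x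
  | x, y :: l => keep x (id y l)

/-- Composition of degeneracy operators. -/
def comp : {x : Y} → {l₁ l₂ l₃ : List Y} →
    Degeneracy x l₁ l₂ → Degeneracy x l₂ l₃ → Degeneracy x l₁ l₃
  | _, _, _, _, f, nil _ => f
  | _, _, _, _, f, dup g => dup (comp f g)
  | _, _, _, _, keep x f, keep _ g => keep x (comp f g)
  | _, _, _, _, dup f, keep _ g => dup (comp f g)

lemma id_comp {x : Y} {l₁ l₂ : List Y} (f : Degeneracy x l₁ l₂) : comp (id x l₁) f = f := by
  induction f with
  | nil x => rfl
  | keep x f ih => simp [id, comp, ih]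
  | dup f ih => simp [comp, ih]

lemma comp_id {x : Y} {l₁ l₂ : List Y} (f : Degeneracy x l₁ l₂) : comp f (id x l₂) = f := by
  induction f with
  | nil x => rfl
  | keep x f ih => simp [id, comp, ih]
  | dup f ih => simp [id, comp, ih]

lemma comp_assoc {x : Y} {l₁ l₂ l₃ l₄ : List Y} (f : Degeneracy x l₁ l₂)
    (g : Degeneracy x l₂ l₃) (h : Degeneracy x l₃ l₄) :
    comp (comp f g) h = comp f (comp g h) := by
  induction h generalizing l₁ l₂ with
  | nil x => rfl
  | dup h ih => simp [comp, ih]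
  | keep x h ih =>
    cases g with
    | dup g => simp [comp, ih]
    | keep _ g =>
      cases f with
      | dup f => simp [comp, ih]
      | keep _ f => simp [comp, ih]

/-- There are finitely many degeneracy operators with a given target. -/
lemma finite_sigma (x : Y) (l : List Y) : Finite (Σ l' : List Y, Degeneracy x l' l) := by
  induction l generalizing x with
  | nil =>
    refine Finite.of_surjective (fun _ : Unit => ⟨[], nil x⟩) ?_
    rintro ⟨_, ⟨⟩⟩
    exact ⟨(), rfl⟩
  | cons y l ih =>
    have := ih x
    have := ih y
    by_cases h : x = y
    · subst h
      refine Finite.of_surjective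
        (α := (Σ l' : List Y, Degeneracy x l' l) ⊕ (Σ l' : List Y, Degeneracy x l' l))
        (Sum.elim (fun p => ⟨x :: p.1, keep x p.2⟩) (fun p => ⟨p.1, dup p.2⟩)) ?_
      rintro ⟨_, f⟩
      cases f with
      | keep _ f => exact ⟨Sum.inl ⟨_, f⟩, rfl⟩
      | dup f => exact ⟨Sum.inr ⟨_, f⟩, rfl⟩
    · refine Finite.of_surjective
        (α := Σ l' : List Y, Degeneracy y l' l) (fun p => ⟨y :: p.1, keep x p.2⟩) ?_
      rintro ⟨_, f⟩
      cases f with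
      | keep _ f => exact ⟨⟨_, f⟩, rfl⟩
      | dup f => exact absurd rfl h

instance (x : Y) (l' l : List Y) : Finite (Degeneracy x l' l) := by
  have := finite_sigma x l
  refine Finite.of_injective
    (fun f => (⟨l', f⟩ : Σ l' : List Y, Degeneracy x l' l)) ?_
  intro f g h
  simpa using h

end Degeneracy

/-- The category of degeneracy operators between nonempty lists with head `x`. -/
structure DegeneracyCat {Y : Type w} (x : Y) where
  tail : List Y

instance {Y : Type w} (x : Y) : SmallCategory (DegeneracyCat x) where
  Hom a b := Degeneracy x a.tail b.tail
  id a := Degeneracy.id x a.tail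
  comp f g := Degeneracy.comp f g
  id_comp := Degeneracy.id_comp
  comp_id := Degeneracy.comp_id
  assoc := Degeneracy.comp_assoc

/-- The category of proper degeneracy operators with target `(x₀, …, xₙ)`, i.e. those from some
`(y₀, …, y_k)` with `k < n`. -/
abbrev LatchingCat {Y : Type w} (x : Y) (l : List Y) : Type w :=
  ObjectProperty.FullSubcategory
    (fun p : Over (DegeneracyCat.mk (x := x) l) => p.left.tail.length < l.length)

instance {Y : Type w} (x : Y) (l : List Y) : Finite (LatchingCat x l) := by
  have := Degeneracy.finite_sigma x l
  refine Finite.of_injective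
    (fun p => (⟨p.obj.left.tail, p.obj.hom⟩ : Σ l' : List Y, Degeneracy x l' l)) ?_
  rintro ⟨⟨⟨a⟩, ⟨⟨⟩⟩, f⟩, ha⟩ ⟨⟨⟨b⟩, ⟨⟨⟩⟩, g⟩, hb⟩ h
  simp only [Sigma.mk.injEq] at h
  obtain ⟨h₁, h₂⟩ := h
  subst h₁
  obtain rfl := eq_of_heq h₂
  rfl

instance {Y : Type w} (x : Y) (l : List Y) (p q : LatchingCat x l) : Finite (p ⟶ q) := by
  have : Finite (p.obj.left ⟶ q.obj.left) :=
    inferInstanceAs (Finite (Degeneracy x p.obj.left.tail q.obj.left.tail))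
  refine Finite.of_injective (fun f => f.hom.left) ?_
  intro f g h
  exact ObjectProperty.hom_ext _ (Over.OverMorphism.ext h)

noncomputable instance {Y : Type w} (x : Y) (l : List Y) : FinCategory (LatchingCat x l) where
  fintypeObj := Fintype.ofFinite _
  fintypeHom _ _ := Fintype.ofFinite _

variable {W : Type u₂} [Category.{v₂} W] [MonoidalCategory W] {Y : Type w}
  [EnrichedCategory W Y] (M : EnrichedBimodule W Y)

/-- `Y(x, y₁) ⊗ Y(y₁, y₂) ⊗ ⋯ ⊗ Y(y_{n-1}, y_n) ⊗ M(y_n, x₀)`. For `x₀ = x` this is the summand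
indexed by `(x, y₁, …, y_n)` of the `n`-th object of the simplicial bar construction. -/
def barSummand (x₀ : Y) : Y → List Y → W
  | x, [] => M.obj x x₀
  | x, y :: l => (x ⟶[W] y) ⊗ barSummand x₀ y l

/-- The map between summands of the bar construction induced by a degeneracy operator: it
inserts identities of `Y`. -/
def barDegeneracy (x₀ : Y) : {x : Y} → {l' l : List Y} → Degeneracy x l' l →
    (barSummand M x₀ x l' ⟶ barSummand M x₀ x l)
  | _, _, _, .nil x => 𝟙 (M.obj x x₀)
  | _, _, _, .keep x (y := y) f => (x ⟶[W] y) ◁ barDegeneracy x₀ f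
  | x, _, _, .dup (l := l) f =>
      barDegeneracy x₀ f ≫ (λ_ (barSummand M x₀ x l)).inv ≫ eId W x ▷ barSummand M x₀ x l

lemma insert_unit_naturality {A B C U : W} (h : C ⟶ A) (φ : A ⟶ B) (e : 𝟙_ W ⟶ U) :
    h ≫ φ ≫ (λ_ B).inv ≫ e ▷ B = (h ≫ (λ_ A).inv ≫ e ▷ A) ≫ U ◁ φ := by
  simp only [Category.assoc]
  rw [leftUnitor_inv_naturality_assoc, whisker_exchange]

lemma barDegeneracy_id (x₀ x : Y) (l : List Y) :
    barDegeneracy M x₀ (Degeneracy.id x l) = 𝟙 _ := by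
  induction l generalizing x with
  | nil => rfl
  | cons y l ih => simp [Degeneracy.id, barDegeneracy, ih, barSummand]

lemma barDegeneracy_comp (x₀ : Y) {x : Y} {l₁ l₂ l₃ : List Y} (f : Degeneracy x l₁ l₂)
    (g : Degeneracy x l₂ l₃) :
    barDegeneracy M x₀ (f.comp g) = barDegeneracy M x₀ f ≫ barDegeneracy M x₀ g := by
  induction g generalizing l₁ with
  | nil x => cases f; simp [Degeneracy.comp, barDegeneracy, barSummand]
  | dup g ih => simp [Degeneracy.comp, barDegeneracy, ih]
  | keep x g ih =>
    cases f with
    | keep _ f =>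
      simp only [Degeneracy.comp, barDegeneracy, ih]
      exact MonoidalCategory.whiskerLeft_comp _ _ _
    | dup f =>
      simp only [Degeneracy.comp, barDegeneracy, ih, Category.assoc]
      exact insert_unit_naturality _ _ _

/-- The summands of the bar construction, as a functor on degeneracy operators. -/
def barFunctor (x₀ x : Y) : DegeneracyCat x ⥤ W where
  obj a := barSummand M x₀ x a.tail
  map f := barDegeneracy M x₀ f
  map_id a := barDegeneracy_id M x₀ x a.tail
  map_comp f g := barDegeneracy_comp M x₀ f g

/-- The colimit of all summands of domains of degeneracy maps (from degrees `k < n`) that map into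
the summand `(x, y₁, …, y_n)`; for `x₀ = x` this is the latching object `L_{x, y₁, …, y_n}`. -/
noncomputable def latchingObject [HasFiniteColimits W] (x₀ x : Y) (l : List Y) : W :=
  colimit ((ObjectProperty.ι _ : LatchingCat x l ⥤ _) ⋙ Over.forget _ ⋙ barFunctor M x₀ x)

end Bar

section Weight

/-- The summand `B_{x₀,…,xₙ}(Y, M)` of the bar construction. -/
def barTerm {W : Type u₂} [Category.{v₂} W] [MonoidalCategory W] {Y : Type w}
    [EnrichedCategory W Y] (M : EnrichedBimodule W Y) {n : ℕ} (x : Fin (n + 1) → Y) : W :=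
  barSummand M (x 0) (x 0) (List.ofFn fun i : Fin n => x i.succ)

/-- The latching object `L_{x₀,…,xₙ} B(Y, M)`. -/
noncomputable def latchingTerm {W : Type u₂} [Category.{v₂} W] [MonoidalCategory W]
    [HasFiniteColimits W] {Y : Type w} [EnrichedCategory W Y] (M : EnrichedBimodule W Y) {n : ℕ}
    (x : Fin (n + 1) → Y) : W :=
  latchingObject M (x 0) (x 0) (List.ofFn fun i : Fin n => x i.succ)

variable {V : Type u₁} [Category.{v₁} V] [SemiCartesianMonoidalCategory V]
  {W : Type u₂} [Category.{v₂} W] [MonoidalCategory W] [ModelCategory W]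
  {k : Type u} [CommRing k]

/-- `wgt(x₀, …, xₙ) = χ(B_{x₀,…,xₙ}(Σ X, 𝟙)) - χ(L_{x₀,…,xₙ} B(Σ X, 𝟙))`. -/
noncomputable def wgt (χ : EulerCharacteristic W k) (S : V ⥤ W) [S.Monoidal] (X : Type w)
    [EnrichedCategory V X] {n : ℕ} (x : Fin (n + 1) → X) : k :=
  χ.chi (barTerm (unitBimodule S X) x) - χ.chi (latchingTerm (unitBimodule S X) x)

/-- The formal power series `∑ₙ tⁿ ∑_{x₀,…,xₙ} wgt(x₀, …, xₙ)`. -/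
noncomputable def wgtSeries (χ : EulerCharacteristic W k) (S : V ⥤ W) [S.Monoidal] (X : Type w)
    [EnrichedCategory V X] [Fintype X] : PowerSeries k :=
  PowerSeries.mk fun n => ∑ x : Fin (n + 1) → X, wgt χ S X x

end Weight

/-! ### Power series that are rational functions -/

section Rational

/-- The power series `F ∈ k[[t]]` is a rational function `P / Q`, where `P` and `Q` are polynomials
and `Q` is invertible in `k[[t]]`, which can be evaluated at `t = a` (i.e. `Q(a)` is invertible),
with value `P(a) / Q(a) = v`. -/
def IsRationalWithValue {k : Type u} [CommRing k] (F : PowerSeries k) (a v : k) : Prop :=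
  ∃ P Q : Polynomial k, IsUnit (Q : PowerSeries k) ∧ (Q : PowerSeries k) * F = (P : PowerSeries k) ∧
    IsUnit (Q.eval a) ∧ Q.eval a * v = P.eval a

/-- The value does not depend on the choice of `P` and `Q`. -/
theorem IsRationalWithValue.unique {k : Type u} [CommRing k] {F : PowerSeries k} {a v v' : k}
    (h : IsRationalWithValue F a v) (h' : IsRationalWithValue F a v') : v = v' := by
  obtain ⟨P, Q, -, hF, hu, hv⟩ := h
  obtain ⟨P', Q', -, hF', hu', hv'⟩ := h'
  have h₁ : Q * P' = Q' * P := by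
    apply Polynomial.coe_injective k
    rw [Polynomial.coe_mul, Polynomial.coe_mul, ← hF, ← hF']
    ring
  have h₂ := congrArg (Polynomial.eval a) h₁
  rw [Polynomial.eval_mul, Polynomial.eval_mul, ← hv, ← hv'] at h₂
  exact (hu.mul hu').mul_left_cancel (by linear_combination -h₂)


open RatFunc in
/-- Over a field `K`, `IsRationalWithValue` says that the image of `F` in `K((t))` is the image of
an element of `K(t)` whose denominator does not vanish at `a` and whose value at `a` is `v`. -/
theorem isRationalWithValue_iff {K : Type u} [Field K] (F : PowerSeries K) (a v : K) :
    IsRationalWithValue F a v ↔ ∃ r : RatFunc K,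
      algebraMap (RatFunc K) (LaurentSeries K) r = HahnSeries.ofPowerSeries ℤ K F ∧
      r.denom.eval a ≠ 0 ∧ r.eval (RingHom.id K) a = v := by
  have key (P : Polynomial K) : algebraMap (RatFunc K) (LaurentSeries K)
      (algebraMap (Polynomial K) (RatFunc K) P) = HahnSeries.ofPowerSeries ℤ K (P : PowerSeries K) :=
    (RatFunc.coe_coe P).symm
  constructor
  · rintro ⟨P, Q, hQ, hF, hu, hv⟩
    have hQ0 : Q ≠ 0 := by
      rintro rfl
      simp at hu
    have hQ1 : algebraMap (Polynomial K) (RatFunc K) Q ≠ 0 := RatFunc.algebraMap_ne_zero hQ0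
    have hd : (algebraMap (Polynomial K) (RatFunc K) P / algebraMap _ _ Q).denom.eval a ≠ 0 := by
      intro h
      obtain ⟨c, hc⟩ := RatFunc.denom_div_dvd P Q
      apply hu.ne_zero
      rw [hc, Polynomial.eval_mul, h, zero_mul]
    refine ⟨algebraMap _ _ P / algebraMap _ _ Q, ?_, hd, ?_⟩
    · rw [map_div₀, div_eq_iff ((map_ne_zero _).2 hQ1), key, key, ← map_mul, ← hF, mul_comm]
    · rw [RatFunc.eval, div_eq_iff (by simpa using hd)]
      have h := congrArg (Polynomial.eval a) ((RatFunc.num_mul_eq_mul_denom_iff (x :=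
        algebraMap (Polynomial K) (RatFunc K) P / algebraMap _ _ Q) hQ0).2 rfl)
      rw [Polynomial.eval_mul, Polynomial.eval_mul, ← hv] at h
      rw [← Polynomial.eval, ← Polynomial.eval]
      exact mul_left_cancel₀ hu.ne_zero (by linear_combination h)
  · rintro ⟨r, hr, hd, hv⟩
    have hF : (r.denom : PowerSeries K) * F = (r.num : PowerSeries K) := by
      apply HahnSeries.ofPowerSeries_injective (Γ := ℤ)
      rw [map_mul, ← hr, ← key, ← key, ← map_mul, mul_comm]
      congr 1
      rw [← eq_div_iff (RatFunc.algebraMap_ne_zero r.denom_ne_zero), RatFunc.num_div_denom]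
    refine ⟨r.num, r.denom, ?_, hF, hd.isUnit, ?_⟩
    · rw [PowerSeries.isUnit_iff_constantCoeff, isUnit_iff_ne_zero, Polynomial.constantCoeff_coe]
      intro h0
      have h1 : r.num.coeff 0 = 0 := by
        have := congrArg (PowerSeries.constantCoeff (R := K)) hF
        rwa [map_mul, Polynomial.constantCoeff_coe, Polynomial.constantCoeff_coe, h0, zero_mul,
          eq_comm] at this
      obtain ⟨x, y, hxy⟩ := r.isCoprime_num_denom
      have := congrArg (fun p : Polynomial K => p.coeff 0) hxy
      simp [Polynomial.mul_coeff_zero, h0, h1] at this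
    · rw [← hv, RatFunc.eval, ← Polynomial.eval, ← Polynomial.eval]
      exact mul_div_cancel₀ _ hd

end Rational

/-! Write `Z` for the zeta matrix and `A = Z - 1`. The theorem reduces to `wgt(x₀, …, xₙ) = A(x₀,
x₁) ⋯ A(xₙ₋₁, xₙ)`. Summing over all tuples turns `F(t)` into `∑ tⁿ ∑ₐᵦ (Aⁿ)ₐᵦ`, the entry sum of
`(1 - tA)⁻¹`. By Cramer's rule this is rational with denominator `det (1 - tA)`, and at `t = -1` the
matrix `1 - tA` is `Z` (`isRationalWithValue_sum_pow`).

The product formula comes from a recursion on the list `x :: y :: l`. Write `B`, `L` for the summand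
and latching object at `y :: l`, and `H` for the hom-object from `x` to `y`. A proper operator into
`x :: y :: l` is either `keep f` with `f` proper, or, only if `x = y`, `dup f` with `f` arbitrary.
The first kind contributes `H ⊗ L` because `H ⊗ -` preserves colimits. The second contributes `B`,
since every `dup f` factors through `dup id`. They are glued along `L`. So the new latching object
is `H ⊗ L` if `x ≠ y` (`consOfNe`), and the pushout of `H ⊗ L ⟵ L ⟶ B` if `x = y` (`consOfPushout`).

For `χ` to be additive on that pushout, both legs must be cofibrations and `L` cofibrant. This is
carried through the induction in `exists_latchingData`: if `x ≠ y` the new latching map is `H ◁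
L.map`, and if `x = y` it is the pushout product of the identity-assigning map with the old latching
map. The closing vertex `x₀` stays fixed while the head `x` varies, so the tail of a tuple is again
of the form treated. -/

/-! ### Latching objects by universal property, and their recursion in the list. -/

section LatchingData

variable {W : Type u₂} [Category.{v₂} W] [MonoidalCategory W] {Y : Type w}
  [EnrichedCategory W Y]

lemma Degeneracy.length_le {Y : Type w} {x : Y} {l' l : List Y} (f : Degeneracy x l' l) :
    l'.length ≤ l.length := by
  induction f with
  | nil x => exact le_rfl
  | keep x f ih => simpa using ih
  | dup f ih => exact ih.trans (by simp)

/-- The map `A ⟶ Hom(x, x) ⊗ A` given by the identity of `x`. -/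
def insertUnit (x : Y) (A : W) : A ⟶ (x ⟶[W] x) ⊗ A :=
  (λ_ A).inv ≫ eId W x ▷ A

lemma insertUnit_naturality (x : Y) {A B : W} (φ : A ⟶ B) :
    φ ≫ insertUnit x B = insertUnit x A ≫ (x ⟶[W] x) ◁ φ := by
  rw [insertUnit, insertUnit, Category.assoc, leftUnitor_inv_naturality_assoc, whisker_exchange]

lemma insertUnit_naturality_assoc (x : Y) {A B C : W} (φ : A ⟶ B)
    (h : (x ⟶[W] x) ⊗ B ⟶ C) :
    φ ≫ insertUnit x B ≫ h = insertUnit x A ≫ (x ⟶[W] x) ◁ φ ≫ h := by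
  rw [← Category.assoc, insertUnit_naturality, Category.assoc]

/-- A colimit of the summands of the bar construction over all proper degeneracy operators with
target `x :: l`. -/
structure LatchingData (M : EnrichedBimodule W Y) (x₀ x : Y) (l : List Y) where
  pt : W
  leg {l' : List Y} (f : Degeneracy x l' l) (h : l'.length < l.length) :
    barSummand M x₀ x l' ⟶ pt
  w {l'' l' : List Y} (φ : Degeneracy x l'' l') (f : Degeneracy x l' l)
    (h : l'.length < l.length) :
    barDegeneracy M x₀ φ ≫ leg f h = leg (φ.comp f) (φ.length_le.trans_lt h)
  desc {T : W} (t : ∀ {l' : List Y}, Degeneracy x l' l → l'.length < l.length →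
      (barSummand M x₀ x l' ⟶ T))
    (ht : ∀ {l'' l' : List Y} (φ : Degeneracy x l'' l') (f : Degeneracy x l' l)
      (h : l'.length < l.length),
      barDegeneracy M x₀ φ ≫ t f h = t (φ.comp f) (φ.length_le.trans_lt h)) : pt ⟶ T
  fac {T : W} (t : ∀ {l' : List Y}, Degeneracy x l' l → l'.length < l.length →
      (barSummand M x₀ x l' ⟶ T))
    (ht : ∀ {l'' l' : List Y} (φ : Degeneracy x l'' l') (f : Degeneracy x l' l)
      (h : l'.length < l.length),
      barDegeneracy M x₀ φ ≫ t f h = t (φ.comp f) (φ.length_le.trans_lt h))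
    {l' : List Y} (f : Degeneracy x l' l) (h : l'.length < l.length) :
    leg f h ≫ desc t ht = t f h
  hom_ext {T : W} {a b : pt ⟶ T}
    (hab : ∀ {l' : List Y} (f : Degeneracy x l' l) (h : l'.length < l.length),
      leg f h ≫ a = leg f h ≫ b) : a = b

namespace LatchingData

variable {M : EnrichedBimodule W Y} {x₀ x : Y} {l : List Y}

/-- The latching map. -/
def map (L : LatchingData M x₀ x l) : L.pt ⟶ barSummand M x₀ x l :=
  L.desc (fun f _ => barDegeneracy M x₀ f) fun φ f _ => (barDegeneracy_comp M x₀ φ f).symm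

lemma leg_map (L : LatchingData M x₀ x l) {l' : List Y} (f : Degeneracy x l' l)
    (h : l'.length < l.length) : L.leg f h ≫ L.map = barDegeneracy M x₀ f :=
  L.fac _ (fun φ f _ => (barDegeneracy_comp M x₀ φ f).symm) f h

lemma leg_map_assoc (L : LatchingData M x₀ x l) {l' : List Y} (f : Degeneracy x l' l)
    (h : l'.length < l.length) {A : W} (a : barSummand M x₀ x l ⟶ A) :
    L.leg f h ≫ L.map ≫ a = barDegeneracy M x₀ f ≫ a := by
  rw [← Category.assoc, leg_map]

/-- Any two choices of the latching object are isomorphic. -/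
def iso (L L' : LatchingData M x₀ x l) : L.pt ≅ L'.pt where
  hom := L.desc L'.leg L'.w
  inv := L'.desc L.leg L.w
  hom_inv_id := L.hom_ext fun f h => by rw [← Category.assoc, L.fac, L'.fac, Category.comp_id]
  inv_hom_id := L'.hom_ext fun f h => by rw [← Category.assoc, L'.fac, L.fac, Category.comp_id]

variable (M x₀)

/-- The latching object defined as a colimit. -/
noncomputable def ofColimit [HasFiniteColimits W] (x : Y) (l : List Y) :
    LatchingData M x₀ x l where
  pt := latchingObject M x₀ x l
  leg {l'} f h := colimit.ι ((ObjectProperty.ι _ : LatchingCat x l ⥤ _) ⋙ Over.forget _ ⋙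
    barFunctor M x₀ x) ⟨Over.mk (Y := DegeneracyCat.mk l') f, h⟩
  w {l'' l'} φ f h :=
    let F : LatchingCat x l ⥤ W := ObjectProperty.ι _ ⋙ Over.forget _ ⋙ barFunctor M x₀ x
    let p : LatchingCat x l := ⟨Over.mk (Y := DegeneracyCat.mk l'') (φ.comp f),
      φ.length_le.trans_lt h⟩
    let q : LatchingCat x l := ⟨Over.mk (Y := DegeneracyCat.mk l') f, h⟩
    colimit.w F (ObjectProperty.homMk (Over.homMk (U := p.obj) (V := q.obj) φ rfl) : p ⟶ q)
  desc t ht := colimit.desc _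
    { pt := _
      ι :=
        { app p := t p.obj.hom p.property
          naturality p q g := by
            have e : p.obj.hom = Degeneracy.comp g.hom.left q.obj.hom := (Over.w g.hom).symm
            have := ht g.hom.left q.obj.hom q.property
            refine this.trans ?_
            simp only [← e]
            exact (Category.comp_id _).symm } }
  fac t ht l' f h := colimit.ι_desc _ _
  hom_ext hab := colimit.hom_ext fun p => hab p.obj.hom p.property

/-- The latching object in degree `0` is initial. -/
noncomputable def nil [HasInitial W] (x : Y) : LatchingData M x₀ x [] where
  pt := ⊥_ W
  leg _ h := absurd h (by simp)
  w _ _ h := absurd h (by simp)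
  desc _ _ := initial.to _
  fac _ _ _ _ h := absurd h (by simp)
  hom_ext _ := Subsingleton.elim _ _

variable {M x₀}

section

variable (L : LatchingData M x₀ x l) {P : W} (i : (x ⟶[W] x) ⊗ L.pt ⟶ P)
  (j : barSummand M x₀ x l ⟶ P)

/-- The legs of the cocone whose point is a pushout of the latching map and the insertion of the
unit. -/
def legOfPushout : {l' : List Y} → Degeneracy x l' (x :: l) → l'.length < (x :: l).length →
    (barSummand M x₀ x l' ⟶ P)
  | _, .keep _ f, h => (x ⟶[W] x) ◁ L.leg f (Nat.lt_of_succ_lt_succ h) ≫ i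
  | _, .dup f, _ => barDegeneracy M x₀ f ≫ j

variable {i j}

/-- The one cocone condition that mixes the two kinds of legs: `dup φ` followed by `keep f` is `dup
(φ.comp f)`. It is exactly the commutativity of the pushout square. -/
lemma legOfPushout_dup_comp_keep (sq : IsPushout (insertUnit x L.pt) L.map i j)
    {l'' l' : List Y} (φ : Degeneracy x l'' l') (f : Degeneracy x l' l)
    (h : l'.length < l.length) :
    (barDegeneracy M x₀ φ ≫ insertUnit x _) ≫ (x ⟶[W] x) ◁ L.leg f h ≫ i =
      barDegeneracy M x₀ (φ.comp f) ≫ j := by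
  rw [Category.assoc, ← insertUnit_naturality_assoc, sq.w, leg_map_assoc,
    barDegeneracy_comp, Category.assoc]

end

section

variable [MonoidalClosed W] {y : Y}

/-- The universal property of `Hom(x, y) ⊗ L_{y :: l}`. -/
noncomputable def keepDesc (L : LatchingData M x₀ y l) (x : Y) {T : W}
    (t : ∀ {l' : List Y}, Degeneracy y l' l → l'.length < l.length →
      ((x ⟶[W] y) ⊗ barSummand M x₀ y l' ⟶ T))
    (ht : ∀ {l'' l' : List Y} (φ : Degeneracy y l'' l') (f : Degeneracy y l' l)
      (h : l'.length < l.length),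
      (x ⟶[W] y) ◁ barDegeneracy M x₀ φ ≫ t f h = t (φ.comp f) (φ.length_le.trans_lt h)) :
    (x ⟶[W] y) ⊗ L.pt ⟶ T :=
  MonoidalClosed.uncurry (L.desc (fun f h => MonoidalClosed.curry (t f h)) fun φ f h => by
    rw [← MonoidalClosed.curry_natural_left, ht])

lemma whiskerLeft_leg_keepDesc (L : LatchingData M x₀ y l) (x : Y) {T : W}
    (t : ∀ {l' : List Y}, Degeneracy y l' l → l'.length < l.length →
      ((x ⟶[W] y) ⊗ barSummand M x₀ y l' ⟶ T))
    (ht : ∀ {l'' l' : List Y} (φ : Degeneracy y l'' l') (f : Degeneracy y l' l)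
      (h : l'.length < l.length),
      (x ⟶[W] y) ◁ barDegeneracy M x₀ φ ≫ t f h = t (φ.comp f) (φ.length_le.trans_lt h))
    {l' : List Y} (f : Degeneracy y l' l) (h : l'.length < l.length) :
    (x ⟶[W] y) ◁ L.leg f h ≫ L.keepDesc x t ht = t f h := by
  rw [keepDesc, ← MonoidalClosed.uncurry_natural_left, L.fac (fun f h => MonoidalClosed.curry (t f h))
    fun φ f h => by rw [← MonoidalClosed.curry_natural_left, ht], MonoidalClosed.uncurry_curry]

/-- By closedness, maps out of `A ⊗ L.pt` are maps from `L.pt` to an internal hom, so the whiskered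
legs stay jointly epimorphic. -/
lemma whiskerLeft_hom_ext (L : LatchingData M x₀ y l) (A : W) {T : W} {a b : A ⊗ L.pt ⟶ T}
    (hab : ∀ {l' : List Y} (f : Degeneracy y l' l) (h : l'.length < l.length),
      A ◁ L.leg f h ≫ a = A ◁ L.leg f h ≫ b) : a = b := by
  apply MonoidalClosed.curry_injective
  apply L.hom_ext
  intro l' f h
  rw [← MonoidalClosed.curry_natural_left, hab, MonoidalClosed.curry_natural_left]

/-- The legs of the cocone with point `Hom(x, y) ⊗ L_{y :: l}`, if `x ≠ y`. -/
def legOfNe {x : Y} : {y : Y} → {l : List Y} → (L : LatchingData M x₀ y l) → x ≠ y →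
    {l' : List Y} → Degeneracy x l' (y :: l) → l'.length < (y :: l).length →
      (barSummand M x₀ x l' ⟶ (x ⟶[W] y) ⊗ L.pt)
  | y, _, L, _, _, .keep _ f, h => (x ⟶[W] y) ◁ L.leg f (Nat.lt_of_succ_lt_succ h)
  | _, _, _, hxy, _, .dup _, _ => absurd rfl hxy

/-- If `x ≠ y`, then the latching object at `x :: y :: l` is the tensor product of `Hom(x, y)` and
the latching object at `y :: l`. -/
noncomputable def consOfNe (L : LatchingData M x₀ y l) (hxy : x ≠ y) :
    LatchingData M x₀ x (y :: l) where
  pt := (x ⟶[W] y) ⊗ L.pt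
  leg := L.legOfNe hxy
  w φ f h := by
    cases f with
    | dup f => exact absurd rfl hxy
    | keep _ f =>
      cases φ with
      | dup φ => exact absurd rfl hxy
      | keep _ φ =>
        exact (MonoidalCategory.whiskerLeft_comp _ _ _).symm.trans
          (congrArg ((x ⟶[W] y) ◁ ·) (L.w φ f _))
  desc t ht := L.keepDesc x (fun f h => t (.keep x f) (Nat.succ_lt_succ h)) fun φ f h =>
    ht (.keep x φ) (.keep x f) _
  fac t ht l' f h := by
    cases f with
    | dup f => exact absurd rfl hxy
    | keep _ f => exact L.whiskerLeft_leg_keepDesc x _ _ f _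
  hom_ext hab := L.whiskerLeft_hom_ext _ fun f h => hab (.keep x f) (Nat.succ_lt_succ h)

lemma map_consOfNe (L : LatchingData M x₀ y l) (hxy : x ≠ y) :
    (L.consOfNe hxy).map = (x ⟶[W] y) ◁ L.map :=
  (L.consOfNe hxy).hom_ext fun f h => by
    rw [leg_map]
    cases f with
    | dup f => exact absurd rfl hxy
    | keep _ f =>
      exact (congrArg ((x ⟶[W] y) ◁ ·) (L.leg_map f (Nat.lt_of_succ_lt_succ h)).symm).trans
        (MonoidalCategory.whiskerLeft_comp _ _ _)

section

variable (L : LatchingData M x₀ x l) {P : W} {i : (x ⟶[W] x) ⊗ L.pt ⟶ P}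
  {j : barSummand M x₀ x l ⟶ P}

/-- The latching object at `x :: x :: l` is a pushout. -/
noncomputable def consOfPushout (sq : IsPushout (insertUnit x L.pt) L.map i j) :
    LatchingData M x₀ x (x :: l) where
  pt := P
  leg := L.legOfPushout i j
  w φ f h := by
    cases f with
    | dup f =>
      exact ((congrArg (· ≫ j) (barDegeneracy_comp M x₀ φ f)).trans (Category.assoc _ _ _)).symm
    | keep _ f =>
      cases φ with
      | dup φ => exact L.legOfPushout_dup_comp_keep sq φ f _
      | keep _ φ =>
        refine (Category.assoc _ _ _).symm.trans (congrArg (· ≫ i) ?_)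
        exact (MonoidalCategory.whiskerLeft_comp _ _ _).symm.trans
          (congrArg ((x ⟶[W] x) ◁ ·) (L.w φ f _))
  desc t ht := sq.desc
    (L.keepDesc x (fun f h => t (.keep x f) (Nat.succ_lt_succ h)) fun φ f h =>
      ht (.keep x φ) (.keep x f) _)
    (t (.dup (.id x l)) (Nat.lt_succ_self _)) (L.hom_ext fun f h => by
      rw [insertUnit_naturality_assoc, leg_map_assoc]
      refine (congrArg (insertUnit x _ ≫ ·) (L.whiskerLeft_leg_keepDesc x _ _ f h)).trans ?_
      -- The two components agree on `L.pt` because `dup f` factors in two ways: as `dup id`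
      -- followed by `keep f`, and as `f` followed by `dup id`.
      have h₁ := ht (.dup (.id x _)) (.keep x f) (Nat.succ_lt_succ h)
      have h₂ := ht f (.dup (.id x l)) (Nat.lt_succ_self _)
      simp only [Degeneracy.comp, Degeneracy.comp_id, Degeneracy.id_comp] at h₁ h₂
      rw [h₂, ← h₁]
      refine congrArg (· ≫ t (.keep x f) (Nat.succ_lt_succ h)) ?_
      refine (Category.id_comp _).symm.trans (congrArg (· ≫ insertUnit x _) ?_)
      exact (barDegeneracy_id M x₀ x _).symm)
  fac t ht l' f h := by
    cases f with
    | keep _ f =>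
      refine (Category.assoc _ _ _).trans ?_
      rw [sq.inl_desc]
      exact L.whiskerLeft_leg_keepDesc x _ _ f _
    | dup f =>
      refine (Category.assoc _ _ _).trans ?_
      rw [sq.inr_desc, ht]
      simp only [Degeneracy.comp, Degeneracy.comp_id]
  hom_ext {T a b} hab := sq.hom_ext
    (L.whiskerLeft_hom_ext _ fun f h => by
      rw [← Category.assoc, ← Category.assoc]
      exact hab (.keep x f) (Nat.succ_lt_succ h))
    (by
      have := hab (.dup (.id x l)) (Nat.lt_succ_self _)
      simpa only [legOfPushout, barDegeneracy_id, Category.id_comp] using this)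

/-- Together with `inr_map_consOfPushout`, this identifies the latching map with the corner map of a
pushout product, as used in `cofibration_map_consOfPushout`. -/
lemma inl_map_consOfPushout (sq : IsPushout (insertUnit x L.pt) L.map i j) :
    i ≫ (L.consOfPushout sq).map = (x ⟶[W] x) ◁ L.map := by
  refine L.whiskerLeft_hom_ext _ fun f h => ?_
  refine Eq.trans ?_ (MonoidalCategory.whiskerLeft_comp _ _ _)
  rw [leg_map]
  exact (Category.assoc _ _ _).symm.trans
    ((L.consOfPushout sq).leg_map (.keep x f) (Nat.succ_lt_succ h))

lemma inr_map_consOfPushout (sq : IsPushout (insertUnit x L.pt) L.map i j) :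
    j ≫ (L.consOfPushout sq).map = insertUnit x (barSummand M x₀ x l) := by
  have h := (L.consOfPushout sq).leg_map (.dup (.id x l)) (Nat.lt_succ_self _)
  have e : barDegeneracy M x₀ (.id x l) ≫ j = j := by rw [barDegeneracy_id, Category.id_comp]
  refine (congrArg (· ≫ (L.consOfPushout sq).map) e).symm.trans (h.trans ?_)
  exact (congrArg (· ≫ insertUnit x _) (barDegeneracy_id M x₀ x l)).trans (Category.id_comp _)

end

end

end LatchingData

end LatchingData

/-! ### Tensor products of cofibrations and cofibrant objects. -/

section MonoidalModel

variable {W : Type u₂} [Category.{v₂} W] [MonoidalCategory W] [SymmetricCategory W]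
  [MonoidalClosed W] [ModelCategory W]

/-- The tensor product with an initial object is initial. -/
noncomputable def isInitialTensorInitial (A : W) : IsInitial (A ⊗ ⊥_ W) :=
  IsInitial.isInitialObj (tensorLeft A) _ initialIsInitial

/-- The tensor product with an initial object is initial. -/
noncomputable def isInitialInitialTensor (A : W) : IsInitial ((⊥_ W) ⊗ A) :=
  (isInitialTensorInitial A).ofIso (β_ _ _)

variable [IsMonoidalModelCategory W]

/-- This is the pushout product of `∅ ⟶ A` with `f`: tensoring with `∅` gives initial objects, so
the pushout in its source is just `A ⊗ K`. -/
lemma cofibration_whiskerLeft (A : W) [IsCofibrant A] {K L : W} (f : K ⟶ L) [hf : Cofibration f] :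
    Cofibration (A ◁ f) := by
  have : IsIso ((⊥_ W) ◁ f) :=
    isIso_of_isInitial (isInitialInitialTensor K) (isInitialInitialTensor L) _
  have sq : IsPushout (initial.to A ▷ K) ((⊥_ W) ◁ f) (𝟙 (A ⊗ K))
      ((isInitialInitialTensor L).to (A ⊗ K)) :=
    IsPushout.of_vert_isIso ⟨(isInitialInitialTensor K).hom_ext _ _⟩
  exact IsMonoidalModelCategory.cofibration_ι (initial.to A) f
    { pt := A ⊗ K
      inl := 𝟙 _
      inr := (isInitialInitialTensor L).to _
      isPushout := sq
      ι := A ◁ f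
      inl_ι := Category.id_comp _
      inr_ι := (isInitialInitialTensor L).hom_ext _ _ } inferInstance hf

lemma cofibration_whiskerRight {K L : W} (f : K ⟶ L) [Cofibration f] (A : W) [IsCofibrant A] :
    Cofibration (f ▷ A) := by
  have := cofibration_whiskerLeft A f
  have e : f ▷ A = (β_ K A).hom ≫ A ◁ f ≫ (β_ L A).inv := by
    rw [← BraidedCategory.braiding_naturality_left_assoc, Iso.hom_inv_id, Category.comp_id]
  rw [e]
  infer_instance

lemma isCofibrant_tensor (A B : W) [IsCofibrant A] [hB : IsCofibrant B] : IsCofibrant (A ⊗ B) :=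
  (isCofibrant_iff_of_isInitial _ (isInitialTensorInitial A)).2
    (cofibration_whiskerLeft A (initial.to B))

end MonoidalModel

/-! ### Euler characteristics of isomorphic objects and strict pushouts. -/

namespace EulerCharacteristic

variable {W : Type u₂} [Category.{v₂} W] [ModelCategory W] {k : Type u}

section

variable [AddCommGroup k] (χ : EulerCharacteristic W k)

lemma isFinite_iff_of_iso {A B : W} (e : A ≅ B) : χ.IsFinite A ↔ χ.IsFinite B :=
  χ.isFinite_iff_of_weakEquivalence e.hom inferInstance

lemma chi_eq_of_iso {A B : W} (e : A ≅ B) (hA : χ.IsFinite A) : χ.chi A = χ.chi B :=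
  χ.chi_eq_of_weakEquivalence e.hom inferInstance hA

/-- Such a span serves as its own replacement, with identities as the weak equivalences. -/
lemma isHomotopyPushout_of_isPushout {A B C P : W} {f : A ⟶ B} {g : A ⟶ C} {i : B ⟶ P}
    {j : C ⟶ P} (sq : IsPushout f g i j) (hA : IsCofibrant A) (hf : Cofibration f)
    (hg : Cofibration g) : IsHomotopyPushout f g P :=
  ⟨A, B, C, f, g, 𝟙 _, 𝟙 _, 𝟙 _, i, j, hA, hf, hg, inferInstance, inferInstance, inferInstance,
    by simp, by simp, sq⟩

end

end EulerCharacteristic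

/-! ### Sums over paths and the geometric series of a matrix. -/

section PathWeight

/-- The product of the entries of `A` along the path `x :: l`. -/
def pathWeight {Y : Type w} {k : Type u} [CommRing k] (A : Matrix Y Y k) : Y → List Y → k
  | _, [] => 1
  | x, y :: l => A x y * pathWeight A y l

lemma sum_fin_succ_fun {Y : Type w} {k : Type u} [AddCommMonoid k] [Fintype Y] {n : ℕ}
    (f : (Fin (n + 1) → Y) → k) : ∑ x, f x = ∑ y, ∑ x : Fin n → Y, f (Fin.cons y x) := by
  rw [← (Fin.consEquiv fun _ : Fin (n + 1) => Y).sum_comp, Fintype.sum_prod_type]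
  rfl

lemma sum_pathWeight_ofFn {Y : Type w} {k : Type u} [CommRing k] [Fintype Y] [DecidableEq Y]
    (A : Matrix Y Y k) (n : ℕ) (a : Y) :
    ∑ x : Fin n → Y, pathWeight A a (List.ofFn x) = ∑ b, (A ^ n) a b := by
  induction n generalizing a with
  | zero => simp [pathWeight, Matrix.one_apply]
  | succ n ih =>
    simp only [sum_fin_succ_fun, List.ofFn_cons, pathWeight, ← Finset.mul_sum, ih,
      pow_succ', Matrix.mul_apply]
    rw [Finset.sum_comm]
    simp only [Finset.mul_sum]

lemma sum_pathWeight {Y : Type w} {k : Type u} [CommRing k] [Fintype Y] [DecidableEq Y]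
    (A : Matrix Y Y k) (n : ℕ) :
    ∑ x : Fin (n + 1) → Y, pathWeight A (x 0) (List.ofFn fun i : Fin n => x i.succ) =
      ∑ a, ∑ b, (A ^ n) a b := by
  simp only [sum_fin_succ_fun, Fin.cons_zero, Fin.cons_succ, sum_pathWeight_ofFn]

/-- The geometric series of a matrix `A` is rational, with denominator `det (1 - t A)`; its value at
`-1` is the inverse of `1 + A`. -/
lemma isRationalWithValue_sum_pow {Y : Type w} {k : Type u} [CommRing k] [Fintype Y]
    [DecidableEq Y] (A : Matrix Y Y k) (hA : IsUnit (1 + A)) :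
    IsRationalWithValue (PowerSeries.mk fun n => ∑ a, ∑ b, (A ^ n) a b) (-1)
      (∑ a, ∑ b, (1 + A)⁻¹ a b) := by
  -- Over power series `G` is inverse to `N`, so `det N • G = adj N` has polynomial entries. Hence
  -- `Q = det N`, and `P` is the entry sum of `adj N`.
  let N : Matrix Y Y (Polynomial k) := 1 - (Polynomial.X : Polynomial k) • A.map Polynomial.C
  let G : Matrix Y Y (PowerSeries k) := Matrix.of fun a b => PowerSeries.mk fun n => (A ^ n) a b
  let φ : Polynomial k →+* PowerSeries k := Polynomial.coeToPowerSeries.ringHom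
  have hφ (p : Polynomial k) : φ p = (p : PowerSeries k) := rfl
  have hNG : N.map φ * G = 1 := by
    have h1 : N.map φ = 1 - (PowerSeries.X : PowerSeries k) • A.map PowerSeries.C := by
      ext1 a b
      by_cases h : a = b <;> simp [N, φ, h] <;> exact mul_comm _ _
    have h2 : (A.map PowerSeries.C : Matrix Y Y (PowerSeries k)) * G =
        Matrix.of fun a b => PowerSeries.mk fun n => (A ^ (n + 1)) a b := by
      ext a b n
      simp [Matrix.mul_apply, G, pow_succ']
    rw [h1, sub_mul, one_mul, Matrix.smul_mul, h2]
    ext a b n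
    cases n with
    | zero =>
      by_cases h : a = b <;> simp [G, h, Matrix.one_apply]
    | succ n =>
      by_cases h : a = b <;> simp [G, h, Matrix.one_apply, PowerSeries.coeff_succ_X_mul,
        PowerSeries.coeff_one]
  have hadj : (N.det : PowerSeries k) • G = N.adjugate.map φ := by
    have h : N.adjugate.map φ * N.map φ = (N.det : PowerSeries k) • 1 := by
      rw [← Matrix.map_mul, Matrix.adjugate_mul]
      ext1 a b
      by_cases h : a = b <;> simp [h, φ]
    rw [← mul_one (N.adjugate.map φ), ← hNG, ← mul_assoc, h, Matrix.smul_mul, one_mul]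
  have hev : N.map (Polynomial.evalRingHom (-1 : k)) = 1 + A := by
    ext a b
    by_cases h : a = b <;> simp [N, h]
  have hdet : N.det.eval (-1) = (1 + A).det := by
    rw [← hev, ← RingHom.mapMatrix_apply, ← RingHom.map_det]
    rfl
  have hu : IsUnit (1 + A).det := (Matrix.isUnit_iff_isUnit_det _).1 hA
  refine ⟨∑ a, ∑ b, N.adjugate a b, N.det, ?_, ?_, ?_, ?_⟩
  · rw [PowerSeries.isUnit_iff_constantCoeff, Polynomial.constantCoeff_coe,
      Polynomial.coeff_zero_eq_eval_zero]
    -- `det N` is by definition the reversed characteristic polynomial of `A`, whose constant term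
    -- is `det 1 = 1`.
    have : N.det.eval 0 = 1 := A.eval_charpolyRev
    rw [this]
    exact isUnit_one
  · rw [← hφ (∑ a, ∑ b, N.adjugate a b)]
    simp only [map_sum]
    have e : (PowerSeries.mk fun n => ∑ a, ∑ b, (A ^ n) a b) = ∑ a, ∑ b, G a b := by
      ext n
      simp [G]
    rw [e]
    simp only [Finset.mul_sum]
    exact Finset.sum_congr rfl fun a _ => Finset.sum_congr rfl fun b _ =>
      congrFun (congrFun hadj a) b
  · rwa [hdet]
  · rw [hdet]
    simp only [Polynomial.eval_finsetSum, Finset.mul_sum]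
    refine Finset.sum_congr rfl fun a _ => Finset.sum_congr rfl fun b _ => ?_
    -- The adjugate commutes with evaluation at `-1`, so `P(-1)` is the entry sum of `adj (1 + A)`,
    -- which is `det (1 + A)` times that of the inverse.
    have h : (1 + A).adjugate = N.adjugate.map (Polynomial.evalRingHom (-1 : k)) := by
      rw [← hev]
      exact (RingHom.map_adjugate (Polynomial.evalRingHom (-1 : k)) N).symm
    have h' := congrFun (congrFun h a) b
    rw [Matrix.map_apply, Polynomial.coe_evalRingHom] at h'
    rw [← h', Matrix.inv_def, Matrix.smul_apply, smul_eq_mul, ← mul_assoc,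
      Ring.mul_inverse_cancel _ hu, one_mul]

end PathWeight

/-! ### Cofibrancy, finiteness and weights by induction on the list. -/

section Weights

variable {W : Type u₂} [Category.{v₂} W] [MonoidalCategory W]
  [MonoidalClosed W] [ModelCategory W] [IsMonoidalModelCategory W] {k : Type u} [CommRing k]
  {Y : Type w} [EnrichedCategory W Y]

/-- The relative latching map at `x :: x :: l` is a pushout product. -/
lemma LatchingData.cofibration_map_consOfPushout {M : EnrichedBimodule W Y} {x₀ x : Y}
    {l : List Y} (hY : IsCofibrantEnriched W Y) (L : LatchingData M x₀ x l)
    (hL : Cofibration L.map) {P : W} {i : (x ⟶[W] x) ⊗ L.pt ⟶ P} {j : barSummand M x₀ x l ⟶ P}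
    (sq : IsPushout (insertUnit x L.pt) L.map i j) :
    Cofibration (L.consOfPushout sq).map := by
  -- Undoing the left unitors in `insertUnit` brings the square to the form required by the
  -- pushout-product axiom.
  have sq' : IsPushout (eId W x ▷ L.pt) (𝟙_ W ◁ L.map) i ((λ_ _).hom ≫ j) :=
    sq.of_iso (λ_ _).symm (Iso.refl _) (λ_ _).symm (Iso.refl _) (by simp [insertUnit])
      (leftUnitor_inv_naturality _) (by simp) (by simp)
  exact IsMonoidalModelCategory.cofibration_ι (eId W x) L.map
    { pt := P
      inl := i
      inr := (λ_ _).hom ≫ j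
      isPushout := sq'
      ι := (L.consOfPushout sq).map
      inl_ι := L.inl_map_consOfPushout sq
      inr_ι := by
        refine (Category.assoc _ _ _).trans ?_
        refine (congrArg ((λ_ _).hom ≫ ·) (L.inr_map_consOfPushout sq)).trans ?_
        exact Iso.hom_inv_id_assoc _ _ } (hY.2 x) hL

variable [SymmetricCategory W]

lemma cofibration_insertUnit (hY : IsCofibrantEnriched W Y) (x : Y) (A : W) [IsCofibrant A] :
    Cofibration (insertUnit x A) := by
  have := hY.2 x
  have := cofibration_whiskerRight (eId W x) A
  rw [insertUnit]
  infer_instance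

variable [DecidableEq Y] {χ : EulerCharacteristic W k} {M : EnrichedBimodule W Y}

/-- The latching maps of the bar construction are cofibrations between finite cofibrant objects,
and the weights are multiplicative along paths. -/
theorem exists_latchingData (hχ : χ.IsMultiplicative) (hY : IsCofibrantEnriched W Y)
    (hYfin : ∀ x y : Y, χ.IsFinite (x ⟶[W] y)) (hM : ∀ x y, IsCofibrant (M.obj x y))
    (hMfin : ∀ x y, χ.IsFinite (M.obj x y)) (hMchi : ∀ x y, χ.chi (M.obj x y) = 1)
    (x₀ x : Y) (l : List Y) :
    IsCofibrant (barSummand M x₀ x l) ∧ χ.IsFinite (barSummand M x₀ x l) ∧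
    ∃ L : LatchingData M x₀ x l, Cofibration L.map ∧ IsCofibrant L.pt ∧ χ.IsFinite L.pt ∧
      χ.chi (barSummand M x₀ x l) - χ.chi L.pt =
        pathWeight (Matrix.of (fun x y : Y => χ.chi (x ⟶[W] y)) - 1) x l := by
  induction l generalizing x with
  | nil =>
    refine ⟨hM _ _, hMfin _ _, .nil M x₀ x, ?_, ?_, χ.isFinite_initial, ?_⟩
    · have : (LatchingData.nil M x₀ x).map = initial.to (M.obj x x₀) :=
        initialIsInitial.hom_ext _ _
      rw [this]
      exact hM _ _
    · have : initial.to (⊥_ W) = 𝟙 _ := initialIsInitial.hom_ext _ _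
      have h : IsCofibrant (⊥_ W) := by
        rw [isCofibrant_iff, this]
        infer_instance
      exact h
    · refine (congrArg₂ (· - ·) (hMchi x x₀) χ.chi_initial).trans ?_
      simp [pathWeight]
  | cons y l ih =>
    obtain ⟨hB, hBfin, L, hmap, hL, hLfin, hw⟩ := ih y
    have hxy := hY.1 x y
    have hT : IsCofibrant ((x ⟶[W] y) ⊗ L.pt) := isCofibrant_tensor _ _
    have hTfin := hχ.isFinite_tensor _ _ (hYfin x y) hLfin hxy hL
    have hTchi := hχ.chi_tensor _ _ (hYfin x y) hLfin hxy hL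
    have hBchi : χ.chi (barSummand M x₀ x (y :: l)) = _ :=
      hχ.chi_tensor _ _ (hYfin x y) hBfin hxy hB
    refine ⟨isCofibrant_tensor (x ⟶[W] y) (barSummand M x₀ y l),
      hχ.isFinite_tensor _ _ (hYfin x y) hBfin hxy hB, ?_⟩
    by_cases h : x = y
    · subst h
      have hu := cofibration_insertUnit hY x L.pt
      have sq := IsPushout.of_hasPushout (insertUnit x L.pt) L.map
      have hsq := EulerCharacteristic.isHomotopyPushout_of_isPushout sq hL hu hmap
      -- The new latching object is cofibrant: this inclusion is a cobase change of the old latching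
      -- map, and its source `Hom(x, x) ⊗ L.pt` is cofibrant.
      have hc : Cofibration (pushout.inl (insertUnit x L.pt) L.map) :=
        (cofibration_iff _).2 (MorphismProperty.of_isPushout sq hmap.mem)
      have hP := isCofibrant_of_cofibration (pushout.inl (insertUnit x L.pt) L.map)
      refine ⟨L.consOfPushout sq, L.cofibration_map_consOfPushout hY hmap sq, hP,
        χ.isFinite_homotopyPushout _ _ _ hLfin hTfin hBfin hsq, ?_⟩
      have e : χ.chi (L.consOfPushout sq).pt = _ :=
        χ.chi_homotopyPushout _ _ _ hLfin hTfin hBfin hsq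
      -- With `z = χ(Hom(x, x))`, `b = χ(B)` and `c = χ(L)`, the identity is `zb - (zc + b - c) = (z
      -- - 1)(b - c)`; the gluing along `L` accounts for the `-1` on the diagonal.
      rw [e, hBchi, hTchi]
      simp only [pathWeight, ← hw, Matrix.sub_apply, Matrix.of_apply, Matrix.one_apply_eq]
      ring
    · refine ⟨L.consOfNe h, ?_, hT, hTfin, ?_⟩
      · rw [L.map_consOfNe h]
        exact cofibration_whiskerLeft (x ⟶[W] y) L.map
      · have e : χ.chi (L.consOfNe h).pt = _ := hTchi
        rw [e, hBchi]
        simp only [pathWeight, ← hw, Matrix.sub_apply, Matrix.of_apply, Matrix.one_apply_ne h]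
        ring

/-- The colimit is isomorphic to the recursively built latching object, and isomorphisms are weak
equivalences, so finiteness and `χ` transfer. -/
theorem isFinite_latchingObject_and_chi (hχ : χ.IsMultiplicative) (hY : IsCofibrantEnriched W Y)
    (hYfin : ∀ x y : Y, χ.IsFinite (x ⟶[W] y)) (hM : ∀ x y, IsCofibrant (M.obj x y))
    (hMfin : ∀ x y, χ.IsFinite (M.obj x y)) (hMchi : ∀ x y, χ.chi (M.obj x y) = 1)
    (x₀ x : Y) (l : List Y) :
    χ.IsFinite (barSummand M x₀ x l) ∧ χ.IsFinite (latchingObject M x₀ x l) ∧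
      χ.chi (barSummand M x₀ x l) - χ.chi (latchingObject M x₀ x l) =
        pathWeight (Matrix.of (fun x y : Y => χ.chi (x ⟶[W] y)) - 1) x l := by
  obtain ⟨-, hB, L, -, -, hL, hw⟩ := exists_latchingData hχ hY hYfin hM hMfin hMchi x₀ x l
  have e : L.pt ≅ latchingObject M x₀ x l := L.iso (.ofColimit M x₀ x l)
  exact ⟨hB, (χ.isFinite_iff_of_iso e).1 hL, by rw [← χ.chi_eq_of_iso e hL, hw]⟩

end Weights

/-! ### The generating function of the weights and the magnitude. -/

theorem mainTheorem9
    {V : Type u₁} [Category.{v₁} V] [SemiCartesianMonoidalCategory V]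
    {W : Type u₂} [Category.{v₂} W] [MonoidalCategory W] [SymmetricCategory W] [MonoidalClosed W]
    [ModelCategory W] [IsMonoidalModelCategory W]
    {k : Type u} [CommRing k]
    (χ : EulerCharacteristic W k) (hχ : χ.IsMultiplicative)
    (S : V ⥤ W) [S.Monoidal] (hS : ∀ a : V, χ.IsFinite (S.obj a))
    (X : Type w) [Fintype X] [DecidableEq X] [EnrichedCategory V X]
    (hX : IsCofibrantEnriched W (TransportEnrichment S X))
    (hM : HasMobiusInversion (χ.size S) X) :
    (∀ (n : ℕ) (x : Fin (n + 1) → X),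
      χ.IsFinite (barTerm (unitBimodule S X) x) ∧
        χ.IsFinite (latchingTerm (unitBimodule S X) x)) ∧
    IsRationalWithValue (wgtSeries χ S X) (-1) (magnitude (χ.size S) X) := by
  let e : 𝟙_ W ≅ S.obj (𝟙_ V) := Functor.Monoidal.εIso S
  have hcof : IsCofibrant (S.obj (𝟙_ V)) := by
    have : IsCofibrant (𝟙_ W) := IsMonoidalModelCategory.isCofibrant_unit
    exact isCofibrant_of_cofibration e.hom
  have hchi : χ.chi (S.obj (𝟙_ V)) = 1 := by
    rw [← χ.chi_eq_of_iso e hχ.isFinite_unit, hχ.chi_unit]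
  let _ : DecidableEq (TransportEnrichment S X) := inferInstanceAs (DecidableEq X)
  have key (n : ℕ) (x : Fin (n + 1) → X) :=
    isFinite_latchingObject_and_chi (M := unitBimodule S X) hχ hX (fun _ _ => hS _)
      (fun _ _ => hcof) (fun _ _ => hS _) (fun _ _ => hchi) (x 0) (x 0)
      (List.ofFn fun i : Fin n => x i.succ)
  refine ⟨fun n x => ⟨(key n x).1, (key n x).2.1⟩, ?_⟩
  have hZ : 1 + (zetaMatrix (χ.size S) X - 1) = zetaMatrix (χ.size S) X := add_sub_cancel _ _
  have h := isRationalWithValue_sum_pow (zetaMatrix (χ.size S) X - 1) (hZ.symm ▸ hM)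
  rw [hZ] at h
  have hF : wgtSeries χ S X =
      PowerSeries.mk fun n => ∑ a, ∑ b, ((zetaMatrix (χ.size S) X - 1) ^ n) a b := by
    unfold wgtSeries
    congr 1
    funext n
    rw [← sum_pathWeight]
    -- The matrix in `key` has entries `χ` of the hom-objects of `Σ X`; by definition these are the
    -- sizes in `zetaMatrix`.
    exact Finset.sum_congr rfl fun x _ => (key n x).2.2
  rw [hF]
  exact h
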